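/- **Setting.** Let $d\ge 1$ and let $\Sigma\in\mathbb R^{d\times d}$ be a symmetric matrix with orthonormal eigenvectors $\mathbf u_1^*,\dots,\mathbf u_d^*$ and eigenvalues $1=\lambda_1^*>\lambda_2^*>\dots>\lambda_d^*>0$; put $\lambda_{d+1}^*:=0$. Let $1\le K\le d$, $t\in\mathbb N$, and let $\mathbf x_{0,1},\dots,\mathbf x_{0,K}\in\mathbb R^d$ be unit vectors. The deflation method with $t$ steps of power iteration computes, starting from $\Sigma_1=\Sigma$ and for $k=1,\dots,K$, $$\mathbf v_k=\mathbf x_{t},\quad\text{where } \mathbf x_0=\mathbf x_{0,k},\ \ \mathbf x_{s+1}=\frac{\Sigma_k\mathbf x_s}{\|\Sigma_k\mathbf x_s\|_2};\qquad \Sigma_{k+1}=\Sigma_k-\mathbf v_k\mathbf v_k^\top\Sigma_k\mathbf v_k\mathbf v_k^\top .$$ Let $\mathbf u_k$ be a unit eigenvector of $\Sigma_k$ for its largest eigenvalue, with its sign chosen such that $\mathbf u_k^\top\mathbf u_k^*\ge 0$. Assume that $c_0\in(0,\infty)$ satisfies $|\mathbf x_{0,k}^\top\mathbf u_k|>c_0^{-1}$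 for all $k\in[K]$. Write $\mathcal T_k=\lambda_k^*-\lambda_{k+1}^*$ (so $\mathcal T_d=\lambda_d^*$), $\mathcal T_{K,\min}=\min_{k\in[K]}\mathcal T_k$ and $\mathcal G=\max_{k\in[K]}\Bigl(1+\frac{c_0\lambda_k^*\lambda_{k+1}^*}{\lambda_k^*-\lambda_{k+1}^*}\Bigr)$, and let $\varepsilon>0$. We say that the *$\varepsilon$-accuracy guarantee* holds if for every $k\in[K]$ there is a sign $s\in\{1,-1\}$ with $$\|s\,\mathbf v_k-\mathbf u_k^*\|_2\le\varepsilon\quad\text{and}\quad\|s\,\mathbf v_k-\mathbf u_k\|_2\le\varepsilon .$$ **Statement.** (1) There is an absolute constant $C>0$ such that in every such setting (with arbitrary $d,K,\Sigma,c_0,\varepsilon$, initial vectors and $t$), if $$t\ \ge\ C\cdot\frac{\max\bigl\{\log\mathcal G,\ K-k+\log\frac{c_0K}{\varepsilon\,\mathcal T_{K,\min}}\bigr\}}{\log\frac{7\lambda_k^*+\lambda_{k+1}^*}{7\lambda_{k+1}^*+\lambda_k^*}}\quad\text{for all }k\le K,\qquad\text{and}\qquad t\ \ge\ \frac{C}{\log\lambda_k^*-\log\lambda_{k+1}^*}\quad\text{for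 all }k<d,$$ then the $\varepsilon$-accuracy guarantee holds. (2) In particular, with $c_0$ and the spectrum held fixed, $t=\Omega(\log(K/\varepsilon)+K)$ suffices: for all $d$, $\lambda_1^*,\dots,\lambda_d^*$ and $c_0$ there is a constant $C>0$, depending only on these, such that in every setting as above with this spectrum and this $c_0$ (with arbitrary $K\le d$, $\Sigma$, $\varepsilon$, initial vectors and $t$), if $t\ge C\,(\log\frac K\varepsilon+K)$, then the $\varepsilon$-accuracy guarantee holds. -/

import Mathlib

open Real

noncomputable section

namespace HotellingDeflation

/-- Vectors of `ℝ^d` with the Euclidean norm. -/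
abbrev Vec (d : ℕ) := EuclideanSpace ℝ (Fin d)

/-- The matrix-vector product `M x`, as a vector of Euclidean space. -/
def matVec {d : ℕ} (M : Matrix (Fin d) (Fin d) ℝ) (x : Vec d) : Vec d :=
  WithLp.toLp 2 (Matrix.mulVec M x.ofLp)

/-- One step `x ↦ M x / ‖M x‖₂` of power iteration. -/
def powerStep {d : ℕ} (M : Matrix (Fin d) (Fin d) ℝ) (x : Vec d) : Vec d :=
  ‖matVec M x‖⁻¹ • matVec M x

/-- The result of `t` steps of power iteration for `M`, started at `x₀`. -/
def powerIteration {d : ℕ} (M : Matrix (Fin d) (Fin d) ℝ) (x₀ : Vec d) (t : ℕ) : Vec d :=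
  (powerStep M)^[t] x₀

/-- Hotelling's deflation `M - v vᵀ M v vᵀ`. -/
def deflate {d : ℕ} (M : Matrix (Fin d) (Fin d) ℝ) (v : Vec d) : Matrix (Fin d) (Fin d) ℝ :=
  M - Matrix.vecMulVec v.ofLp v.ofLp * M * Matrix.vecMulVec v.ofLp v.ofLp

/-- The deflated matrices of the deflation method with `t` steps of power iteration as its
sub-routine, where `x₀ k` is the initial vector of the `k`-th power iteration.  Here and below
indices start at `0`: `deflated S x₀ t k` is the matrix usually written `Σ_{k+1}`. -/
def deflated {d : ℕ} (S : Matrix (Fin d) (Fin d) ℝ) (x₀ : ℕ → Vec d) (t : ℕ) :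
    ℕ → Matrix (Fin d) (Fin d) ℝ
  | 0 => S
  | k + 1 => deflate (deflated S x₀ t k) (powerIteration (deflated S x₀ t k) (x₀ k) t)

/-- The approximate eigenvectors returned by the deflation method. -/
def output {d : ℕ} (S : Matrix (Fin d) (Fin d) ℝ) (x₀ : ℕ → Vec d) (t : ℕ) (k : ℕ) : Vec d :=
  powerIteration (deflated S x₀ t k) (x₀ k) t

/-- `u` is a unit eigenvector of `M` for the largest eigenvalue of `M`. -/
def IsTopEigenvector {d : ℕ} (M : Matrix (Fin d) (Fin d) ℝ) (u : Vec d) : Prop :=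
  ‖u‖ = 1 ∧ ∃ μ : ℝ, matVec M u = μ • u ∧
    ∀ ν : ℝ, Module.End.HasEigenvalue (Matrix.toLin' M) ν → ν ≤ μ

/-- The sequence of eigenvalues, continued by `0` beyond the last one. -/
def eig {d : ℕ} (lam : Fin d → ℝ) (k : ℕ) : ℝ :=
  if h : k < d then lam ⟨k, h⟩ else 0

/-- The eigengaps; the last one is the smallest eigenvalue itself. -/
def gap {d : ℕ} (lam : Fin d → ℝ) (k : ℕ) : ℝ :=
  eig lam k - eig lam (k + 1)

/-- The smallest of the first `K` eigengaps (for `K ≥ 1`). -/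
def minGap {d : ℕ} (lam : Fin d → ℝ) (K : ℕ) : ℝ :=
  ⨅ k : Fin K, gap lam k

/-- The maximum over the first `K` indices of `1 + c₀ λ_k λ_{k+1} / (λ_k - λ_{k+1})`
(for `K ≥ 1`). -/
def growth {d : ℕ} (lam : Fin d → ℝ) (c₀ : ℝ) (K : ℕ) : ℝ :=
  ⨆ k : Fin K, (1 + c₀ * eig lam k * eig lam (k + 1) / (eig lam k - eig lam (k + 1)))

/-- `S` is a real symmetric matrix with eigenvalues `1 = λ_1 > λ_2 > ⋯ > λ_d > 0` and
corresponding orthonormal eigenvectors `ustar`. -/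
structure HasSimplePositiveSpectrum {d : ℕ} (S : Matrix (Fin d) (Fin d) ℝ) (lam : Fin d → ℝ)
    (ustar : Fin d → Vec d) : Prop where
  isSymm : S.IsSymm
  orthonormal : Orthonormal ℝ ustar
  eigenvector : ∀ i, matVec S (ustar i) = lam i • ustar i
  strictAnti : StrictAnti lam
  pos : ∀ i, 0 < lam i
  first : ∀ i : Fin d, i.val = 0 → lam i = 1

/-- The assumptions on the unit initial vectors `x₀ k` of the first `K` power iterations:
`u k` is the unit top eigenvector of the `k`-th deflated matrix, with the sign for which
`⟨u k, ustar k⟩ ≥ 0`, and `x₀ k` has overlap larger than `1 / c₀` with it. -/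
structure GoodInitialization {d : ℕ} (S : Matrix (Fin d) (Fin d) ℝ) (ustar : Fin d → Vec d)
    (x₀ u : ℕ → Vec d) (t : ℕ) (c₀ : ℝ) (K : ℕ) : Prop where
  norm_eq_one : ∀ k < K, ‖x₀ k‖ = 1
  topEigenvector : ∀ k < K, IsTopEigenvector (deflated S x₀ t k) (u k)
  oriented : ∀ k : Fin d, k.val < K → 0 ≤ inner ℝ (u k) (ustar k)
  overlap : ∀ k < K, c₀⁻¹ < |inner ℝ (x₀ k) (u k)|

/-- For each of the first `K` indices the returned vector is, up to its sign, within `ε` of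
`ustar k` and of the top eigenvector `u k` of the `k`-th deflated matrix. -/
def Accurate {d : ℕ} (S : Matrix (Fin d) (Fin d) ℝ) (ustar : Fin d → Vec d)
    (x₀ u : ℕ → Vec d) (t : ℕ) (K : ℕ) (ε : ℝ) : Prop :=
  ∀ k : Fin d, k.val < K → ∃ s : ℝ, (s = 1 ∨ s = -1) ∧
    ‖s • output S x₀ t k - ustar k‖ ≤ ε ∧ ‖s • output S x₀ t k - u k‖ ≤ ε

end HotellingDeflation

end

open HotellingDeflation

/-! Errors are prevented from compounding by measuring every output against the original matrix `S`.
Let `θ` bound the error of a single power iteration relative to the top eigenvector of its own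
deflated matrix, and let `g` be the minimal gap. Each output then has residual at most `4θ` for its
deflated operator `M k`. Deflation almost annihilates earlier outputs, and later deflations increase
`‖M k (v j)‖` only additively (`norm_deflated_apply_le`). By symmetry of `M k`, outputs are
therefore nearly orthogonal, so undoing the deflations shows that `v k` has residual `O(K²θ/g)` for
`S` (`norm_residual_le`). Dividing by the gap puts it within `η = O(K²θ/g²)` of the true eigenvector
(`norm_orthPart_le_of_residual`), with the same `η` for every `k`. The accumulated perturbation
`O(Kη)` of `M k` has only to be small compared with `g²`: it secures the contraction rate
(`top_eigenvector_perturbation`, `contraction_of_perturbation`), identifies the eigenvalue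
approximated, and fixes the sign. The induction step `accurateStep_of_lt` combines these facts. It
thus suffices that `θ` is polynomially small in `g`, `1/K` and `ε`, that is, that `t` times the
logarithmic rate exceeds a multiple of `log (c₀ K / (ε g))`. For `K = 1` this logarithm may be too
small; there is then no deflation error, and the second bound on `t` helps. -/

namespace HotellingDeflation

/-! ### Power iteration, residuals and rank-one operators in an inner product space. -/

section Abstract

variable {E : Type*} [NormedAddCommGroup E] [InnerProductSpace ℝ E]

/-- The component of a vector orthogonal to a unit vector `u`. -/
def orthPart (u x : E) : E := x - inner ℝ u x • u

lemma inner_orthPart {u : E} (hu : ‖u‖ = 1) (x : E) : inner ℝ u (orthPart u x) = 0 := by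
  simp [orthPart, inner_sub_right, inner_smul_right, hu]

lemma norm_orthPart_sq {u : E} (hu : ‖u‖ = 1) (x : E) :
    ‖orthPart u x‖ ^ 2 = ‖x‖ ^ 2 - inner ℝ u x ^ 2 := by
  rw [orthPart, norm_sub_sq_real, norm_smul, inner_smul_right, hu, real_inner_comm,
    Real.norm_eq_abs, mul_one, sq_abs]
  ring

/-- Here `κ` bounds the tangent of the angle to `u`. Both `u` and its orthogonal complement are
invariant, so normalization does not affect the tangent and one step multiplies it by at most `b /
a`. The nonzero overlap keeps `T x` away from zero. -/
lemma power_step_bound {T : E →ₗ[ℝ] E} (hT : T.IsSymmetric) {u : E} (hu : ‖u‖ = 1) {μ a b : ℝ}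
    (hTu : T u = μ • u) (ha : 0 < a) (haμ : a ≤ μ) (hb : 0 ≤ b)
    (hperp : ∀ x, inner ℝ u x = 0 → ‖T x‖ ≤ b * ‖x‖) {κ : ℝ} {x : E}
    (hux : inner ℝ u x ≠ 0) (hκ : ‖orthPart u x‖ ≤ κ * |inner ℝ u x|) :
    ‖‖T x‖⁻¹ • T x‖ = 1 ∧ inner ℝ u (‖T x‖⁻¹ • T x) ≠ 0 ∧
      ‖orthPart u (‖T x‖⁻¹ • T x)‖ ≤ κ * (b / a) * |inner ℝ u (‖T x‖⁻¹ • T x)| := by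
  have hμ : 0 < μ := ha.trans_le haμ
  have huT : inner ℝ u (T x) = μ * inner ℝ u x := by
    rw [← hT u x, hTu, inner_smul_left]; simp
  have huT0 : inner ℝ u (T x) ≠ 0 := by rw [huT]; exact mul_ne_zero hμ.ne' hux
  have hTx : T x ≠ 0 := by
    intro h; rw [h, inner_zero_right] at huT0; exact huT0 rfl
  have hn : 0 < ‖T x‖ := norm_pos_iff.2 hTx
  have hdec : orthPart u (T x) = T (orthPart u x) := by
    rw [orthPart, huT, orthPart, map_sub, map_smul, hTu, smul_smul, mul_comm]
  have hsm : orthPart u (‖T x‖⁻¹ • T x) = ‖T x‖⁻¹ • orthPart u (T x) := by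
    simp [orthPart, inner_smul_right, smul_sub, smul_smul]
  have hκ0 : 0 ≤ κ := by
    by_contra h
    have := mul_neg_of_neg_of_pos (not_le.1 h) (abs_pos.2 hux)
    linarith [norm_nonneg (orthPart u x)]
  refine ⟨?_, ?_, ?_⟩
  · rw [norm_smul, norm_inv, norm_norm, inv_mul_cancel₀ hn.ne']
  · rw [inner_smul_right]; exact mul_ne_zero (inv_ne_zero hn.ne') huT0
  · rw [hsm, norm_smul, inner_smul_right, abs_mul, hdec, norm_inv, norm_norm, abs_inv, abs_norm,
      huT, abs_mul, abs_of_pos hμ]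
    have h1 := hperp _ (inner_orthPart hu x)
    have h2 : b * ‖orthPart u x‖ ≤ b * (κ * |inner ℝ u x|) := by gcongr
    have h3 : b * (κ * |inner ℝ u x|) ≤ κ * (b / a) * (μ * |inner ℝ u x|) := by
      have : κ * (b / a) * (μ * |inner ℝ u x|) = b * (κ * |inner ℝ u x|) * (μ / a) := by
        field_simp
      rw [this]
      exact le_mul_of_one_le_right (by positivity) ((one_le_div ha).2 haμ)
    calc ‖T x‖⁻¹ * ‖T (orthPart u x)‖ ≤ ‖T x‖⁻¹ * (κ * (b / a) * (μ * |inner ℝ u x|)) := by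
          gcongr; linarith
      _ = _ := by ring

lemma power_iterate_bound {T : E →ₗ[ℝ] E} (hT : T.IsSymmetric) {u : E} (hu : ‖u‖ = 1)
    {μ a b : ℝ} (hTu : T u = μ • u) (ha : 0 < a) (haμ : a ≤ μ) (hb : 0 ≤ b)
    (hperp : ∀ x, inner ℝ u x = 0 → ‖T x‖ ≤ b * ‖x‖) {κ : ℝ} {x : E} (hx : ‖x‖ = 1)
    (hux : inner ℝ u x ≠ 0) (hκ : ‖orthPart u x‖ ≤ κ * |inner ℝ u x|) (s : ℕ) :
    ‖(fun y => ‖T y‖⁻¹ • T y)^[s] x‖ = 1 ∧ inner ℝ u ((fun y => ‖T y‖⁻¹ • T y)^[s] x) ≠ 0 ∧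
      ‖orthPart u ((fun y => ‖T y‖⁻¹ • T y)^[s] x)‖ ≤
        κ * (b / a) ^ s * |inner ℝ u ((fun y => ‖T y‖⁻¹ • T y)^[s] x)| := by
  induction s with
  | zero => simpa using ⟨hx, hux, hκ⟩
  | succ s ih =>
    obtain ⟨-, h2, h3⟩ := ih
    rw [Function.iterate_succ_apply']
    have := power_step_bound hT hu hTu ha haμ hb hperp h2 h3
    rwa [mul_assoc κ, ← pow_succ] at this

lemma abs_inner_le_one {u v : E} (hu : ‖u‖ = 1) (hv : ‖v‖ = 1) : |inner ℝ u v| ≤ 1 := by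
  simpa [hu, hv] using abs_real_inner_le_norm u v

lemma dist_sq_le {u v : E} (hu : ‖u‖ = 1) (hv : ‖v‖ = 1) (h : 0 ≤ inner ℝ u v) :
    ‖v - u‖ ^ 2 ≤ 2 * ‖orthPart u v‖ ^ 2 := by
  rw [norm_orthPart_sq hu, norm_sub_sq_real, hu, hv, real_inner_comm]
  have := (abs_le.1 (abs_inner_le_one hu hv)).2
  nlinarith

lemma exists_sign {u v : E} (hu : ‖u‖ = 1) (hv : ‖v‖ = 1) :
    ∃ s : ℝ, (s = 1 ∨ s = -1) ∧ ‖s • v - u‖ ^ 2 ≤ 2 * ‖orthPart u v‖ ^ 2 := by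
  rcases le_total 0 (inner ℝ u v : ℝ) with h | h
  · exact ⟨1, Or.inl rfl, by simpa using dist_sq_le hu hv h⟩
  · refine ⟨-1, Or.inr rfl, ?_⟩
    have := dist_sq_le (v := -v) hu (by simpa using hv) (by simpa [inner_neg_right] using h)
    have h2 : orthPart u (-v) = -orthPart u v := by
      simp [orthPart, inner_neg_right]; abel
    rw [h2, norm_neg] at this
    simpa using this

lemma rayleigh_le_of_top [FiniteDimensional ℝ E] {T : E →ₗ[ℝ] E} (hT : T.IsSymmetric) {μ : ℝ}
    (h : ∀ ν, Module.End.HasEigenvalue T ν → ν ≤ μ) (x : E) :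
    inner ℝ x (T x) ≤ μ * ‖x‖ ^ 2 := by
  have hx := (hT.eigenvectorBasis rfl).sum_inner_mul_inner x (T x)
  have hn := (hT.eigenvectorBasis rfl).sum_inner_mul_inner x x
  rw [← hx, ← real_inner_self_eq_norm_sq, ← hn, Finset.mul_sum]
  refine Finset.sum_le_sum fun i _ => ?_
  rw [← hT, hT.apply_eigenvectorBasis, inner_smul_left,
    real_inner_comm x]
  have := h _ (hT.hasEigenvalue_eigenvalues rfl i)
  have h2 := mul_self_nonneg (inner ℝ (hT.eigenvectorBasis rfl i) x : ℝ)
  simp only [RCLike.ofReal_real_eq_id, id, conj_trivial] at this ⊢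
  nlinarith [mul_le_mul_of_nonneg_right this h2]

/-- The component of `v` along `u` contributes nothing to `T v - μ v`, which leaves at most `(b +
|μ|) θ`. Replacing `μ` by the Rayleigh quotient projects this vector orthogonally to `v`, and the
quotient's own error is its component along `v`. -/
lemma residual_bounds {T : E →ₗ[ℝ] E} {u v : E} (hv : ‖v‖ = 1) {μ b θ : ℝ}
    (hTu : T u = μ • u) (hperp : ‖T (orthPart u v)‖ ≤ b * ‖orthPart u v‖)
    (hμ : |μ| ≤ 2) (hb : b ≤ 2) (hθ : ‖orthPart u v‖ ≤ θ) :
    ‖T v - inner ℝ v (T v) • v‖ ≤ 4 * θ ∧ |inner ℝ v (T v) - μ| ≤ 4 * θ := by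
  have h1 : T v - μ • v = T (orthPart u v) - μ • orthPart u v := by
    simp only [orthPart, map_sub, map_smul, hTu, smul_sub, smul_comm μ]; abel
  have h2 : ‖T v - μ • v‖ ≤ 4 * θ := by
    rw [h1]
    refine (norm_sub_le _ _).trans ?_
    rw [norm_smul, Real.norm_eq_abs]
    have := norm_nonneg (orthPart u v)
    nlinarith
  have h3 : T v - inner ℝ v (T v) • v = orthPart v (T v - μ • v) := by
    simp [orthPart, inner_sub_right, inner_smul_right, hv, sub_smul]
  have h4 : inner ℝ v (T v) - μ = inner ℝ v (T v - μ • v) := by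
    simp [inner_sub_right, inner_smul_right, hv]
  constructor
  · rw [h3]
    refine le_trans ?_ h2
    refine abs_le_of_sq_le_sq' ?_ (norm_nonneg _) |>.2
    rw [norm_orthPart_sq hv]; nlinarith [sq_nonneg (inner ℝ v (T v - μ • v) : ℝ)]
  · rw [h4]
    refine (abs_real_inner_le_norm _ _).trans ?_
    rwa [hv, one_mul]

/-- The sign disappears because the rank-one operator is quadratic in `v`. Replacing the scalar and
the two copies of the vector one at a time costs `η` each. -/
lemma rank_one_diff {v w : E} {s ρ l η : ℝ} (hv : ‖v‖ = 1) (hw : ‖w‖ = 1)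
    (hs : s = 1 ∨ s = -1) (hl : |l| ≤ 1) (hη : ‖s • v - w‖ ≤ η) (hρ : |ρ - l| ≤ η) (x : E) :
    ‖(ρ * inner ℝ v x) • v - (l * inner ℝ w x) • w‖ ≤ 3 * η * ‖x‖ := by
  have hsv : ‖s • v‖ = 1 := by rcases hs with rfl | rfl <;> simp [hv]
  have e1 : (ρ * inner ℝ v x) • v = (ρ * inner ℝ (s • v) x) • (s • v) := by
    rcases hs with rfl | rfl <;> simp [inner_neg_left]
  rw [e1]
  generalize s • v = y at *
  have e2 : (ρ * inner ℝ y x) • y - (l * inner ℝ w x) • w =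
      ((ρ - l) * inner ℝ y x) • y + l • (inner ℝ (y - w) x • y + inner ℝ w x • (y - w)) := by
    rw [inner_sub_left]; module
  have i1 : |inner ℝ y x| ≤ ‖x‖ := by simpa [hsv] using abs_real_inner_le_norm y x
  have i2 : |inner ℝ w x| ≤ ‖x‖ := by simpa [hw] using abs_real_inner_le_norm w x
  have i3 : |inner ℝ (y - w) x| ≤ η * ‖x‖ :=
    (abs_real_inner_le_norm _ _).trans (by gcongr)
  have hη0 : 0 ≤ η := (norm_nonneg _).trans hη
  rw [e2]
  calc _ ≤ ‖((ρ - l) * inner ℝ y x) • y‖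
        + ‖l • (inner ℝ (y - w) x • y + inner ℝ w x • (y - w))‖ := norm_add_le _ _
    _ ≤ |ρ - l| * |inner ℝ y x| + |l| * (|inner ℝ (y - w) x| * 1 + |inner ℝ w x| * ‖y - w‖) := by
        rw [norm_smul, norm_smul, norm_mul, hsv, mul_one]
        simp only [Real.norm_eq_abs]
        gcongr
        refine (norm_add_le _ _).trans ?_
        rw [norm_smul, norm_smul, hsv]; simp
    _ ≤ η * ‖x‖ + 1 * (η * ‖x‖ * 1 + ‖x‖ * η) := by gcongr
    _ = _ := by ring

end Abstract

/-! ### Additive propagation of residuals through deflation. -/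

section Deflation

variable {E : Type*} [NormedAddCommGroup E] [InnerProductSpace ℝ E]

/-- If the `v j` are approximate eigenvectors of successively deflated operators, then they are
approximately annihilated by all later ones. -/
lemma norm_deflated_apply_le {M : ℕ → E →ₗ[ℝ] E} {v : ℕ → E} {ρ : ℕ → ℝ} {r : ℝ}
    (hsymm : ∀ i, (M i).IsSymmetric)
    (hM : ∀ i x, M (i + 1) x = M i x - (ρ i * inner ℝ (v i) x) • v i) {k : ℕ}
    (hv : ∀ i < k, ‖v i‖ = 1) (hr : ∀ i < k, ‖M i (v i) - ρ i • v i‖ ≤ r) (j : ℕ) (hj : j < k)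
    (n : ℕ) (hn : j + 1 + n ≤ k) : ‖M (j + 1 + n) (v j)‖ ≤ (n + 1) * r := by
  induction n with
  | zero => simpa [hM, real_inner_self_eq_norm_sq, hv j hj] using hr j hj
  | succ n ih =>
    have ih := ih (by omega)
    have hlt : j + 1 + n < k := by omega
    set i := j + 1 + n
    -- Symmetry turns the subtracted coefficient `ρ i ⟨v i, v j⟩` into `⟨v i, M i (v j)⟩` minus a
    -- residual term. The rest is a projection, which does not increase the norm, so each deflation
    -- adds at most `r`.
    have e : M (j + 1 + (n + 1)) (v j) =
        orthPart (v i) (M i (v j)) + inner ℝ (M i (v i) - ρ i • v i) (v j) • v i := by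
      rw [show j + 1 + (n + 1) = i + 1 from rfl, hM, orthPart, inner_sub_left, hsymm i,
        inner_smul_left]
      simp only [conj_trivial]
      module
    rw [e]
    have h1 : ‖orthPart (v i) (M i (v j))‖ ≤ ‖M i (v j)‖ := by
      refine abs_le_of_sq_le_sq' ?_ (norm_nonneg _) |>.2
      rw [norm_orthPart_sq (hv i hlt)]
      nlinarith [sq_nonneg (inner ℝ (v i) (M i (v j)) : ℝ)]
    have h2 : ‖inner ℝ (M i (v i) - ρ i • v i) (v j) • v i‖ ≤ r := by
      rw [norm_smul, hv i hlt, mul_one]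
      refine (abs_real_inner_le_norm _ _).trans ?_
      rw [hv j hj, mul_one]
      exact hr i hlt
    refine (norm_add_le _ _).trans ?_
    push_cast
    linarith

lemma deflated_eq_sub_sum {M : ℕ → E →ₗ[ℝ] E} {v : ℕ → E} {ρ : ℕ → ℝ}
    (hM : ∀ i x, M (i + 1) x = M i x - (ρ i * inner ℝ (v i) x) • v i) (k : ℕ) (x : E) :
    M k x = M 0 x - ∑ i ∈ Finset.range k, (ρ i * inner ℝ (v i) x) • v i := by
  induction k with
  | zero => simp
  | succ k ih => rw [hM, ih, Finset.sum_range_succ]; abel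

/-- The approximate eigenvectors of the deflated operators are approximate eigenvectors of the
original operator. -/
lemma norm_residual_le {M : ℕ → E →ₗ[ℝ] E} {v : ℕ → E} {ρ : ℕ → ℝ} {r g : ℝ}
    (hsymm : ∀ i, (M i).IsSymmetric)
    (hM : ∀ i x, M (i + 1) x = M i x - (ρ i * inner ℝ (v i) x) • v i) {k K : ℕ} (hk : k < K)
    (hv : ∀ i ≤ k, ‖v i‖ = 1) (hr : ∀ i ≤ k, ‖M i (v i) - ρ i • v i‖ ≤ r)
    (hg : 0 < g) (hg1 : g ≤ 1) (hρg : g / 2 ≤ ρ k) (hρ2 : ∀ i < k, |ρ i| ≤ 2) :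
    ‖M 0 (v k) - ρ k • v k‖ ≤ 9 * K ^ 2 * r / g := by
  have hr0 : 0 ≤ r := (norm_nonneg _).trans (hr k le_rfl)
  have hK : (1 : ℝ) ≤ K := by exact_mod_cast (by omega : 1 ≤ K)
  have hkK : (k : ℝ) ≤ K := by exact_mod_cast hk.le
  have hin : ∀ j < k, |inner ℝ (v j) (v k)| ≤ 4 * K * r / g := by
    intro j hj
    obtain ⟨n, rfl⟩ : ∃ n, k = j + 1 + n := ⟨k - (j + 1), by omega⟩
    have h1 := norm_deflated_apply_le hsymm hM (k := j + 1 + n) (fun i hi => hv i hi.le)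
      (fun i hi => hr i hi.le) j hj n le_rfl
    set k := j + 1 + n
    have hnK : (n : ℝ) + 1 ≤ K := by exact_mod_cast (by omega : n + 1 ≤ K)
    -- Near-orthogonality: `M k` nearly annihilates `v j` and nearly scales `v k` by `ρ k`, which is
    -- at least `g / 2`.
    have e : ρ k * inner ℝ (v j) (v k) =
        inner ℝ (M k (v j)) (v k) - inner ℝ (v j) (M k (v k) - ρ k • v k) := by
      rw [inner_sub_right, inner_smul_right, hsymm k]; ring
    have h2 : |ρ k * inner ℝ (v j) (v k)| ≤ 2 * K * r := by
      rw [e]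
      refine (abs_sub _ _).trans ?_
      have a1 := abs_real_inner_le_norm (M k (v j)) (v k)
      have a2 := abs_real_inner_le_norm (v j) (M k (v k) - ρ k • v k)
      rw [hv k le_rfl, mul_one] at a1
      rw [hv j hj.le, one_mul] at a2
      have := hr k le_rfl
      nlinarith
    rw [abs_mul, abs_of_pos (by linarith)] at h2
    rw [le_div_iff₀ hg]
    nlinarith [abs_nonneg (inner ℝ (v j) (v k) : ℝ)]
  have e : M 0 (v k) - ρ k • v k = (M k (v k) - ρ k • v k) +
      ∑ i ∈ Finset.range k, (ρ i * inner ℝ (v i) (v k)) • v i := by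
    rw [deflated_eq_sub_sum hM k]; abel
  have hsum : ‖∑ i ∈ Finset.range k, (ρ i * inner ℝ (v i) (v k)) • v i‖
      ≤ k * (2 * (4 * K * r / g)) := by
    refine (norm_sum_le _ _).trans ?_
    refine (Finset.sum_le_card_nsmul _ _ (2 * (4 * K * r / g)) fun i hi => ?_).trans ?_
    · have hi := Finset.mem_range.1 hi
      rw [norm_smul, hv i hi.le, mul_one, norm_mul, Real.norm_eq_abs, Real.norm_eq_abs]
      exact mul_le_mul (hρ2 i hi) (hin i hi) (abs_nonneg _) (by norm_num)
    · simp
  rw [e]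
  refine (norm_add_le _ _).trans ?_
  have h3 : r ≤ K ^ 2 * r / g := by
    rw [le_div_iff₀ hg]
    have : r * g ≤ r * 1 := by gcongr
    have : r * 1 ≤ r * K ^ 2 := by gcongr; nlinarith
    linarith
  have h4 : k * (2 * (4 * K * r / g)) ≤ K * (2 * (4 * K * r / g)) := by gcongr
  have h5 : K * (2 * (4 * K * r / g)) = 8 * (K ^ 2 * r / g) := by ring
  have h6 := hr k le_rfl
  have h7 : 9 * K ^ 2 * r / g = 9 * (K ^ 2 * r / g) := by ring
  linarith

end Deflation

/-! ### Perturbation of eigenvectors in an orthonormal eigenbasis. -/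

section Spectral

variable {E : Type*} [NormedAddCommGroup E] [InnerProductSpace ℝ E] {d : ℕ}

lemma norm_sq_eq_sum (b : OrthonormalBasis (Fin d) ℝ E) (x : E) :
    ‖x‖ ^ 2 = ∑ j, inner ℝ (b j) x ^ 2 := by
  rw [← real_inner_self_eq_norm_sq, ← b.sum_inner_mul_inner]
  exact Finset.sum_congr rfl fun j _ => by rw [real_inner_comm, sq]

/-- An approximate eigenvector whose approximate eigenvalue is far from all eigenvalues but one
is close to the eigenvector for this one. -/
lemma norm_orthPart_le_of_residual (b : OrthonormalBasis (Fin d) ℝ E) {S : E →ₗ[ℝ] E}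
    {lam : Fin d → ℝ} (hS : ∀ j x, inner ℝ (b j) (S x) = lam j * inner ℝ (b j) x)
    {ρ h : ℝ} (hh : 0 < h) {k : Fin d} (hsep : ∀ j, j ≠ k → h ≤ |lam j - ρ|) (v : E) :
    ‖orthPart (b k) v‖ ≤ ‖S v - ρ • v‖ / h := by
  rw [le_div_iff₀ hh]
  refine abs_le_of_sq_le_sq' ?_ (norm_nonneg _) |>.2
  rw [mul_pow, norm_sq_eq_sum b, norm_sq_eq_sum b, Finset.sum_mul]
  refine Finset.sum_le_sum fun j _ => ?_
  have e : inner ℝ (b j) (S v - ρ • v) = (lam j - ρ) * inner ℝ (b j) v := by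
    rw [inner_sub_right, inner_smul_right, hS]; ring
  rw [e, mul_pow]
  by_cases hj : j = k
  · subst hj
    rw [inner_orthPart (b.norm_eq_one j)]
    simp only [ne_eq, OfNat.ofNat_ne_zero, not_false_eq_true, zero_pow, zero_mul]
    positivity
  · have e2 : inner ℝ (b j) (orthPart (b k) v) = inner ℝ (b j) v := by
      simp [orthPart, inner_sub_right, inner_smul_right, b.inner_eq_zero hj]
    rw [e2, mul_comm]
    have : h ^ 2 ≤ (lam j - ρ) ^ 2 := by
      rw [← sq_abs (lam j - ρ)]; gcongr; exact hsep j hj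
    gcongr

/-- An operator close to the tail of a spectral decomposition: its top eigenvector is close to
the leading eigenvector of the tail, and it is small on the orthogonal complement. -/
lemma top_eigenvector_perturbation (b : OrthonormalBasis (Fin d) ℝ E) {A : E → E} {M : E →ₗ[ℝ] E}
    {lam : Fin d → ℝ} {k : Fin d} {l' β μ : ℝ}
    (hA : ∀ j x, inner ℝ (b j) (A x) = if j < k then 0 else lam j * inner ℝ (b j) x)
    (hlam : ∀ j, 0 ≤ lam j) (hl' : 0 ≤ l') (htail : ∀ j, k < j → lam j ≤ l') (hgap : l' < lam k)
    (hβ : ∀ x, ‖M x - A x‖ ≤ β * ‖x‖)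
    {u : E} (hu : ‖u‖ = 1) (hMu : M u = μ • u) (htop : ∀ x, inner ℝ x (M x) ≤ μ * ‖x‖ ^ 2) :
    |μ - lam k| ≤ β ∧ (lam k - l') * (1 - inner ℝ (b k) u ^ 2) ≤ 2 * β ∧
      ∀ x, inner ℝ u x = 0 → ‖A x‖ ^ 2 ≤ (l' ^ 2 + 2 * β * (lam k + l')) * ‖x‖ ^ 2 := by
  have hdiff : ∀ x, |inner ℝ x (M x) - inner ℝ x (A x)| ≤ β * ‖x‖ ^ 2 := fun x => by
    rw [← inner_sub_right]
    refine (abs_real_inner_le_norm _ _).trans ?_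
    nlinarith [hβ x, norm_nonneg x]
  have hquad : ∀ x, inner ℝ x (A x) ≤ lam k * inner ℝ (b k) x ^ 2
      + l' * (‖x‖ ^ 2 - inner ℝ (b k) x ^ 2) := fun x => by
    rw [norm_sq_eq_sum b, ← b.sum_inner_mul_inner x (A x),
      ← Finset.add_sum_erase _ _ (Finset.mem_univ k),
      ← Finset.add_sum_erase (a := k) _ (fun j => (inner ℝ (b j) x : ℝ) ^ 2) (Finset.mem_univ k),
      add_sub_cancel_left, Finset.mul_sum]
    refine add_le_add (le_of_eq ?_) (Finset.sum_le_sum fun j hj => ?_)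
    · rw [hA, if_neg (lt_irrefl k), real_inner_comm]; ring
    · rw [hA]
      split_ifs with h
      · rw [mul_zero]; positivity
      · have := htail j (lt_of_le_of_ne (not_lt.1 h) (Finset.ne_of_mem_erase hj).symm)
        rw [real_inner_comm]
        nlinarith [mul_le_mul_of_nonneg_right this (sq_nonneg (inner ℝ (b j) x : ℝ))]
  have hAk : inner ℝ (b k) (A (b k)) = lam k := by
    rw [hA, if_neg (lt_irrefl k), real_inner_self_eq_norm_sq, b.norm_eq_one]; simp
  have hμ : inner ℝ u (M u) = μ := by
    rw [hMu, inner_smul_right, real_inner_self_eq_norm_sq, hu]; simp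
  -- The vector `b k` serves as a test vector; comparing with the quadratic form at `u` then gives
  -- `h2`.
  have h1 : lam k - β ≤ μ := by
    have a1 := htop (b k)
    have a2 := hdiff (b k)
    rw [b.norm_eq_one] at a1 a2
    rw [hAk] at a2
    have := (abs_le.1 a2).1
    linarith
  have a1 := (abs_le.1 (hdiff u)).2
  have a2 := hquad u
  have a3 : inner ℝ (b k) u ^ 2 ≤ 1 := by
    rw [← sq_abs]; exact pow_le_one₀ (abs_nonneg _) (abs_inner_le_one (b.norm_eq_one k) hu)
  rw [hμ, hu] at a1
  rw [hu] at a2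
  have h2 : (lam k - l') * (1 - inner ℝ (b k) u ^ 2) ≤ 2 * β := by linarith
  refine ⟨abs_le.2 ⟨by linarith, by nlinarith⟩, h2, fun x hx => ?_⟩
  -- Since `x ⊥ u`, only the part of `b k` orthogonal to `u` pairs with `x`.
  have hxk : inner ℝ (b k) x ^ 2 ≤ (1 - inner ℝ (b k) u ^ 2) * ‖x‖ ^ 2 := by
    have e : inner ℝ (b k) x = inner ℝ (orthPart u (b k)) x := by
      simp [orthPart, inner_sub_left, inner_smul_left, hx]
    have h3 := abs_real_inner_le_norm (orthPart u (b k)) x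
    have h4 := norm_orthPart_sq hu (b k)
    rw [b.norm_eq_one, real_inner_comm] at h4
    rw [e, ← sq_abs]
    calc _ ≤ (‖orthPart u (b k)‖ * ‖x‖) ^ 2 := by gcongr
      _ = _ := by rw [mul_pow, h4]; ring
  have hAx : ‖A x‖ ^ 2 ≤ lam k ^ 2 * inner ℝ (b k) x ^ 2
      + l' ^ 2 * (‖x‖ ^ 2 - inner ℝ (b k) x ^ 2) := by
    rw [norm_sq_eq_sum b, norm_sq_eq_sum b x,
      ← Finset.add_sum_erase _ _ (Finset.mem_univ k),
      ← Finset.add_sum_erase (a := k) _ (fun j => (inner ℝ (b j) x : ℝ) ^ 2) (Finset.mem_univ k),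
      add_sub_cancel_left, Finset.mul_sum]
    refine add_le_add (le_of_eq ?_) (Finset.sum_le_sum fun j hj => ?_)
    · rw [hA, if_neg (lt_irrefl k)]; ring
    · rw [hA]
      split_ifs with h
      · rw [zero_pow two_ne_zero]; positivity
      · have := htail j (lt_of_le_of_ne (not_lt.1 h) (Finset.ne_of_mem_erase hj).symm)
        rw [mul_pow]
        have := hlam j
        gcongr
  have h5 : (lam k ^ 2 - l' ^ 2) * inner ℝ (b k) x ^ 2
      ≤ (lam k ^ 2 - l' ^ 2) * ((1 - inner ℝ (b k) u ^ 2) * ‖x‖ ^ 2) := by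
    gcongr
    nlinarith
  -- Factoring `lam k ^ 2 - l' ^ 2` lets the gap absorb the angle bound `h2`, so no division by the
  -- gap occurs.
  have h6 : (lam k + l') * ‖x‖ ^ 2 * ((lam k - l') * (1 - inner ℝ (b k) u ^ 2))
      ≤ (lam k + l') * ‖x‖ ^ 2 * (2 * β) := by
    gcongr
    have := hlam k
    positivity
  nlinarith

end Spectral

/-! ### The induction step: accuracy of one more output. -/

section Induction

variable {E : Type*} [NormedAddCommGroup E] [InnerProductSpace ℝ E] {d : ℕ}

/-- The `k`-th approximate eigenvector `v k` is accurate: it nearly is an eigenvector of the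
`k`-th deflated operator, and up to its sign it is close to `w k` and `u k`. -/
structure AccurateStep (M : ℕ → E →ₗ[ℝ] E) (v u w : ℕ → E) (ρ l : ℕ → ℝ) (θ η : ℝ) (k : ℕ) :
    Prop where
  norm_eq_one : ‖v k‖ = 1
  residual : ‖M k (v k) - ρ k • v k‖ ≤ 4 * θ
  rayleigh : |ρ k - l k| ≤ η
  close : ∃ s : ℝ, (s = 1 ∨ s = -1) ∧ ‖s • v k - w k‖ ≤ η ∧ ‖s • v k - u k‖ ≤ 2 * θ

/-- The operator `S` without the first `k` terms of its spectral decomposition. -/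
def spectralTail (S : E →ₗ[ℝ] E) (w : ℕ → E) (l : ℕ → ℝ) (k : ℕ) (x : E) : E :=
  S x - ∑ i ∈ Finset.range k, (l i * inner ℝ (w i) x) • w i

lemma inner_spectralTail (b : OrthonormalBasis (Fin d) ℝ E) {S : E →ₗ[ℝ] E} {w : ℕ → E}
    {l : ℕ → ℝ} (hw : ∀ j : Fin d, w j = b j)
    (hS : ∀ (j : Fin d) x, inner ℝ (b j) (S x) = l j * inner ℝ (b j) x) (k j : Fin d) (x : E) :
    inner ℝ (b j) (spectralTail S w l k x) = if j < k then 0 else l j * inner ℝ (b j) x := by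
  have h : ∀ i ∈ Finset.range (k : ℕ), inner ℝ (b j) ((l i * inner ℝ (w i) x) • w i) =
      if (j : ℕ) = i then l j * inner ℝ (b j) x else 0 := by
    intro i hi
    have hi : i < d := (Finset.mem_range.1 hi).trans k.2
    rw [hw ⟨i, hi⟩, inner_smul_right, b.inner_eq_ite]
    by_cases hij : j = ⟨i, hi⟩
    · subst hij; simp
    · have : (j : ℕ) ≠ i := fun h => hij (Fin.ext h)
      simp [hij, this]
  rw [spectralTail, inner_sub_right, inner_sum, Finset.sum_congr rfl h, Finset.sum_ite_eq, hS]
  simp only [Finset.mem_range, Fin.lt_def]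
  split_ifs <;> simp

/-- Both operators arise from `M 0` by subtracting `k` rank-one terms, which are compared pairwise
by `rank_one_diff`. -/
lemma norm_sub_spectralTail_le {M : ℕ → E →ₗ[ℝ] E}
    {v u w : ℕ → E} {ρ l : ℕ → ℝ} {θ η : ℝ}
    (hM : ∀ i x, M (i + 1) x = M i x - (ρ i * inner ℝ (v i) x) • v i)
    (hl : ∀ i, |l i| ≤ 1) {k : ℕ} (hw : ∀ i < k, ‖w i‖ = 1)
    (hgood : ∀ i < k, AccurateStep M v u w ρ l θ η i) (x : E) :
    ‖M k x - spectralTail (M 0) w l k x‖ ≤ k * (3 * η) * ‖x‖ := by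
  rw [deflated_eq_sub_sum hM, spectralTail, sub_sub_sub_cancel_left, ← Finset.sum_sub_distrib]
  refine (norm_sum_le _ _).trans ?_
  refine (Finset.sum_le_card_nsmul _ _ (3 * η * ‖x‖) fun i hi => ?_).trans ?_
  · have hi := Finset.mem_range.1 hi
    have h := hgood i hi
    obtain ⟨s, hs, h1, -⟩ := h.close
    rw [norm_sub_rev]
    exact rank_one_diff h.norm_eq_one (hw i hi) hs (hl i) h1 h.rayleigh x
  · simp [mul_assoc]

/-- The smallness of the perturbation yields the contraction rate of the power iteration. -/
lemma contraction_of_perturbation {A : E → E} {M : E →ₗ[ℝ] E} {x : E} {l l' β : ℝ}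
    (hl' : 0 ≤ l') (hl : l ≤ 1) (hgap : l' < l) (hβ0 : 0 ≤ β)
    (hβ : β ≤ (l - l') ^ 2 / 2000) (hMA : ‖M x - A x‖ ≤ β * ‖x‖)
    (hA : ‖A x‖ ^ 2 ≤ (l' ^ 2 + 2 * β * (l + l')) * ‖x‖ ^ 2) :
    ‖M x‖ ≤ (7 * l' + l) / 8 * ‖x‖ := by
  have h1 : ‖A x‖ ≤ (l' + (l - l') / 16) * ‖x‖ := by
    refine abs_le_of_sq_le_sq' ?_ (mul_nonneg (by linarith) (norm_nonneg _)) |>.2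
    rw [mul_pow]
    refine hA.trans ?_
    gcongr
    -- With `δ = l - l'`, the excess is at most `4 β ≤ δ ^ 2 / 500`, below `(δ / 16) ^ 2`. Another
    -- `δ / 16` covers `M - A`, and `l' + δ / 8 = (7 l' + l) / 8`.
    have : 2 * β * (l + l') ≤ 4 * β := by nlinarith
    nlinarith [mul_nonneg hl' (sub_nonneg.2 hgap.le), sq_nonneg (l - l')]
  have h2 : β ≤ (l - l') / 16 := by nlinarith
  calc ‖M x‖ = ‖A x + (M x - A x)‖ := by congr 1; abel
    _ ≤ ‖A x‖ + ‖M x - A x‖ := norm_add_le _ _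
    _ ≤ (l' + (l - l') / 16) * ‖x‖ + (l - l') / 16 * ‖x‖ := by
        gcongr
        exact hMA.trans (by gcongr)
    _ = _ := by ring

-- The hypothesis on earlier outputs enters the final bound only qualitatively: it gives a crude
-- estimate `β` that locates `ρ k` and `u k`. The accuracy `η` is then derived afresh from the
-- residual for `M 0`, which is why it is the same for all `k`.
set_option maxHeartbeats 1600000 in
lemma accurateStep_of_lt (b : OrthonormalBasis (Fin d) ℝ E) {M : ℕ → E →ₗ[ℝ] E}
    {v u w x₀ : ℕ → E} {ρ l : ℕ → ℝ} {θ g c₀ : ℝ} {K t : ℕ} (hw : ∀ j : Fin d, w j = b j)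
    (hS : ∀ (j : Fin d) x, inner ℝ (b j) (M 0 x) = l j * inner ℝ (b j) x)
    (hsymm : ∀ i, (M i).IsSymmetric) (hρ : ∀ i, ρ i = inner ℝ (v i) (M i (v i)))
    (hM : ∀ i x, M (i + 1) x = M i x - (ρ i * inner ℝ (v i) x) • v i)
    (hl0 : ∀ i, 0 ≤ l i) (hl1 : ∀ i, l i ≤ 1) (hanti : Antitone l) (hKd : K ≤ d) (hg : 0 < g)
    (hgap : ∀ i < K, g ≤ l i - l (i + 1)) (hc₀ : 0 < c₀)
    (hu : ∀ k < K, ‖u k‖ = 1)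
    (htop : ∀ k < K, ∃ μ : ℝ, M k (u k) = μ • u k ∧ ∀ x, inner ℝ x (M k x) ≤ μ * ‖x‖ ^ 2)
    (horient : ∀ k < K, 0 ≤ inner ℝ (w k) (u k))
    (hx₀ : ∀ k < K, ‖x₀ k‖ = 1) (hover : ∀ k < K, c₀⁻¹ < |inner ℝ (u k) (x₀ k)|)
    (hv : ∀ k < K, v k = (fun y => ‖M k y‖⁻¹ • M k y)^[t] (x₀ k))
    (hpow : ∀ k < K, c₀ * ((7 * l (k + 1) + l k) / (7 * l k + l (k + 1))) ^ t ≤ θ)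
    (hθ : 0 ≤ θ) (hsmall : 10 ^ 6 * K ^ 3 * θ ≤ g ^ 4) {k : ℕ} (hk : k < K)
    (hgood : ∀ i < k, AccurateStep M v u w ρ l θ (144 * K ^ 2 * θ / g ^ 2) i) :
    AccurateStep M v u w ρ l θ (144 * K ^ 2 * θ / g ^ 2) k := by
  obtain ⟨μ, hMu, hray⟩ := htop k hk
  set η := 144 * K ^ 2 * θ / g ^ 2 with hη
  set β := K * (3 * η) with hβ
  have hη0 : 0 ≤ η := by positivity
  have hβ0 : 0 ≤ β := by positivity
  have hK : (1 : ℝ) ≤ K := by exact_mod_cast (by omega : 1 ≤ K)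
  have hgk := hgap k hk
  have hlk := hl1 k
  have hl' := hl0 (k + 1)
  have hlgap : l (k + 1) < l k := by linarith
  have hg1 : g ≤ 1 := by linarith
  -- Since `β = 432 K³ θ / g²`, this is where the factor `10 ^ 6` of `hsmall` is spent.
  have hβg : β ≤ g ^ 2 / 2000 := by
    have : β * g ^ 2 = 432 * (K ^ 3 * θ) := by rw [hβ, hη]; field_simp; ring
    have h2 : β * g ^ 2 ≤ g ^ 2 / 2000 * g ^ 2 := by
      rw [this]; nlinarith [pow_pos hg 4]
    exact le_of_mul_le_mul_right h2 (by positivity)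
  have hηβ : 3 * η ≤ β := by rw [hβ]; exact le_mul_of_one_le_left (by positivity) hK
  have hθg : θ ≤ g / 10 ^ 6 := by
    have a : θ ≤ K ^ 3 * θ := le_mul_of_one_le_left hθ (one_le_pow₀ hK)
    have a' : g ^ 4 ≤ g := by simpa using pow_le_pow_of_le_one hg.le hg1 (by norm_num : 1 ≤ 4)
    linarith
  have hg2 : g ^ 2 ≤ g := by nlinarith
  have hkd : k < d := hk.trans_le hKd
  have hwn : ∀ i < d, ‖w i‖ = 1 := fun i hi => by rw [hw ⟨i, hi⟩, b.norm_eq_one]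
  have hMA : ∀ x, ‖M k x - spectralTail (M 0) w l k x‖ ≤ β * ‖x‖ := fun x => by
    refine (norm_sub_spectralTail_le hM (fun i => by rw [abs_of_nonneg (hl0 i)]; exact hl1 i)
      (fun i hi => hwn i (hi.trans hkd)) hgood x).trans ?_
    rw [hβ]
    gcongr
  obtain ⟨hμ, hc, hA⟩ := top_eigenvector_perturbation b (k := ⟨k, hkd⟩) (lam := fun j => l j)
    (l' := l (k + 1)) (fun j x => inner_spectralTail b hw hS ⟨k, hkd⟩ j x) (fun j => hl0 j) hl'
    (fun j hj => hanti (Nat.succ_le_of_lt (Fin.lt_def.1 hj))) hlgap hMA (hu k hk) hMu hray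
  rw [← hw] at hc
  simp only at hc hA hμ
  have hβgap : β ≤ (l k - l (k + 1)) ^ 2 / 2000 := by
    refine hβg.trans ?_
    gcongr
  have hcontr : ∀ x, inner ℝ (u k) x = 0 →
      ‖M k x‖ ≤ (7 * l (k + 1) + l k) / 8 * ‖x‖ := fun x hx =>
    contraction_of_perturbation hl' hlk hlgap hβ0 hβgap (hMA x) (hA x hx)
  obtain ⟨hμ1, hμ2⟩ := abs_le.1 hμ
  have hover' := hover k hk
  have hinv : 0 < c₀⁻¹ := inv_pos.2 hc₀
  -- The value `a = (7 l k + l (k + 1)) / 8` lies an eighth of the gap below `l k`, leaving room for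
  -- the error `β` of `μ`. The initial tangent is at most `c₀` because the overlap exceeds `c₀⁻¹`.
  have hiter := power_iterate_bound (hsymm k) (hu k hk) hMu (a := (7 * l k + l (k + 1)) / 8)
    (by linarith) (by nlinarith) (by linarith) hcontr (hx₀ k hk)
    (abs_pos.1 (hinv.trans hover')) (κ := c₀) (by
      have h1 : ‖orthPart (u k) (x₀ k)‖ ≤ 1 := by
        refine abs_le_of_sq_le_sq' ?_ zero_le_one |>.2
        rw [norm_orthPart_sq (hu k hk), hx₀ k hk]
        nlinarith [sq_nonneg (inner ℝ (u k) (x₀ k) : ℝ)]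
      refine h1.trans ?_
      rw [← mul_inv_cancel₀ hc₀.ne']
      gcongr) t
  rw [← hv k hk] at hiter
  obtain ⟨hvn, -, hvo⟩ := hiter
  have hvθ : ‖orthPart (u k) (v k)‖ ≤ θ := by
    refine hvo.trans (le_trans ?_ (hpow k hk))
    rw [div_div_div_cancel_right₀ (by norm_num)]
    refine mul_le_of_le_one_right ?_ (abs_inner_le_one (hu k hk) hvn)
    have := hl0 k
    positivity
  obtain ⟨hres, hrμ⟩ := residual_bounds hvn hMu (hcontr _ (inner_orthPart (hu k hk) _))
    (abs_le.2 ⟨by linarith, by linarith⟩) (by linarith) hvθ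
  rw [← hρ] at hres hrμ
  obtain ⟨hr1, hr2⟩ := abs_le.1 hrμ
  have hηsmall : η ≤ g / 2000 := by linarith
  have hρk : |ρ k - l k| ≤ g / 4 := abs_le.2 ⟨by linarith, by linarith⟩
  obtain ⟨hρ1, hρ2⟩ := abs_le.1 hρk
  have hSres := norm_residual_le hsymm hM (k := k) (K := K) (r := 4 * θ) hk
    (fun i hi => by
      rcases hi.lt_or_eq with h | rfl
      · exact (hgood i h).norm_eq_one
      · exact hvn)
    (fun i hi => by
      rcases hi.lt_or_eq with h | rfl
      · exact (hgood i h).residual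
      · exact hres)
    hg hg1 (by linarith)
    (fun i hi => by
      have := abs_le.1 (hgood i hi).rayleigh
      exact abs_le.2 ⟨by linarith [hl0 i], by linarith [hl1 i]⟩)
  -- As `ρ k` is within `g / 4` of `l k`, every other eigenvalue remains at distance at least `g /
  -- 2`.
  have hsep : ∀ j : Fin d, j ≠ ⟨k, hkd⟩ → g / 2 ≤ |l j - ρ k| := by
    intro j hj
    rcases lt_or_gt_of_ne (fun h => hj (Fin.ext h) : (j : ℕ) ≠ k) with h | h
    · have a1 := hanti (Nat.succ_le_of_lt h)
      have a2 := hgap j (h.trans hk)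
      refine le_trans ?_ (le_abs_self _)
      simp only [Nat.succ_eq_add_one] at a1
      linarith
    · have a1 := hanti (Nat.succ_le_of_lt h)
      refine le_trans ?_ (neg_le_abs _)
      simp only [Nat.succ_eq_add_one] at a1
      linarith
  have hvw := norm_orthPart_le_of_residual b (lam := fun j => l j) hS (half_pos hg) hsep (v k)
  rw [← hw] at hvw
  simp only at hvw
  -- This explains `144 = 2 * 72`: half of `η` bounds the orthogonal part, and the spare factor `2`
  -- absorbs the `√2` of `dist_sq_le`.
  have hη2 : 9 * K ^ 2 * (4 * θ) / g / (g / 2) = η / 2 := by rw [hη]; field_simp; ring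
  have hvw' : ‖orthPart (w k) (v k)‖ ≤ η / 2 := by
    rw [← hη2]
    exact hvw.trans (by gcongr)
  have hres' : ‖M 0 (v k) - ρ k • v k‖ ≤ η / 4 := by
    refine hSres.trans ?_
    have e : 9 * K ^ 2 * (4 * θ) / g = η / 4 * g := by rw [hη]; field_simp; ring
    rw [e]
    exact mul_le_of_le_one_right (by positivity) hg1
  -- The orientation of `u k` and the angle bound `hc` make this overlap large, so the sign aligning
  -- `v k` with `u k` also aligns it with `w k`.
  have hcu : 1 / 2 ≤ inner ℝ (w k) (u k) := by
    have := horient k hk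
    by_contra hcon
    have h1 : (3 / 4 : ℝ) ≤ 1 - inner ℝ (w k) (u k) ^ 2 := by nlinarith
    have h2 := mul_le_mul hgk h1 (by norm_num) (by linarith)
    linarith
  obtain ⟨s, hs, hsu⟩ := exists_sign (hu k hk) hvn
  have hsu' : ‖s • v k - u k‖ ≤ 2 * θ := by
    refine abs_le_of_sq_le_sq' ?_ (by positivity) |>.2
    nlinarith [norm_nonneg (orthPart (u k) (v k))]
  have hsn : ‖s • v k‖ = 1 := by rcases hs with rfl | rfl <;> simp [hvn]
  have hwk := hwn k hkd
  have hwsv : 1 / 4 ≤ inner ℝ (w k) (s • v k) := by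
    have e : inner ℝ (w k) (s • v k) = inner ℝ (w k) (u k) + inner ℝ (w k) (s • v k - u k) := by
      rw [inner_sub_right]; ring
    have h1 := abs_real_inner_le_norm (w k) (s • v k - u k)
    rw [hwk, one_mul] at h1
    have := (abs_le.1 h1).1
    rw [e]; linarith
  have horths : ‖orthPart (w k) (s • v k)‖ = ‖orthPart (w k) (v k)‖ := by
    rw [← sq_eq_sq₀ (norm_nonneg _) (norm_nonneg _), norm_orthPart_sq hwk, norm_orthPart_sq hwk,
      hsn, hvn, inner_smul_right]
    rcases hs with rfl | rfl <;> ring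
  refine ⟨hvn, hres, ?_, s, hs, ?_, hsu'⟩
  -- Pairing the residual for `M 0`, at most `η / 4`, with `w k` isolates `l k - ρ k` times an
  -- overlap of at least `1 / 4`.
  · have e : inner ℝ (w k) (M 0 (v k) - ρ k • v k) = (l k - ρ k) * inner ℝ (w k) (v k) := by
      rw [inner_sub_right, inner_smul_right, hw ⟨k, hkd⟩, hS]; ring
    have h1 := abs_real_inner_le_norm (w k) (M 0 (v k) - ρ k • v k)
    rw [e, hwk, one_mul, abs_mul] at h1
    have h2 : 1 / 4 ≤ |inner ℝ (w k) (v k)| := by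
      rw [inner_smul_right] at hwsv
      refine hwsv.trans ((le_abs_self _).trans ?_)
      rw [abs_mul]
      rcases hs with rfl | rfl <;> simp
    rw [abs_sub_comm]
    nlinarith [abs_nonneg (l k - ρ k)]
  · refine abs_le_of_sq_le_sq' ?_ hη0 |>.2
    refine (dist_sq_le hwk hsn (by linarith)).trans ?_
    rw [horths]
    nlinarith [norm_nonneg (orthPart (w k) (v k))]

end Induction

/-! ### Translation from matrices to symmetric operators. -/

section Matrices

variable {d : ℕ}

/-- The linear map on Euclidean space given by a matrix. -/
noncomputable abbrev op (M : Matrix (Fin d) (Fin d) ℝ) : Vec d →ₗ[ℝ] Vec d := Matrix.toEuclideanLin M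

lemma op_apply (M : Matrix (Fin d) (Fin d) ℝ) (x : Vec d) : op M x = matVec M x := rfl

lemma powerStep_eq (M : Matrix (Fin d) (Fin d) ℝ) :
    powerStep M = fun y => ‖op M y‖⁻¹ • op M y := rfl

lemma op_isSymmetric {M : Matrix (Fin d) (Fin d) ℝ} (hM : M.IsSymm) : (op M).IsSymmetric := by
  rw [Matrix.isSymmetric_toEuclideanLin_iff, Matrix.IsHermitian,
    Matrix.conjTranspose_eq_transpose_of_trivial]
  exact hM

lemma deflate_isSymm {M : Matrix (Fin d) (Fin d) ℝ} (hM : M.IsSymm) (v : Vec d) :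
    (deflate M v).IsSymm := by
  rw [Matrix.IsSymm, deflate, Matrix.transpose_sub, Matrix.transpose_mul, Matrix.transpose_mul,
    hM.eq, Matrix.transpose_vecMulVec, Matrix.mul_assoc]

lemma deflated_isSymm {S : Matrix (Fin d) (Fin d) ℝ} (hS : S.IsSymm) (x₀ : ℕ → Vec d) (t k : ℕ) :
    (deflated S x₀ t k).IsSymm := by
  induction k with
  | zero => exact hS
  | succ k ih => exact deflate_isSymm ih _

lemma op_vecMulVec (v x : Vec d) :
    op (Matrix.vecMulVec v.ofLp v.ofLp) x = (inner ℝ v x : ℝ) • v := by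
  ext i
  simp [op_apply, matVec, Matrix.vecMulVec_mulVec, PiLp.inner_apply, dotProduct, mul_comm]

lemma op_deflate (M : Matrix (Fin d) (Fin d) ℝ) (v x : Vec d) :
    op (deflate M v) x = op M x - (inner ℝ v (op M v) * inner ℝ v x) • v := by
  have h : op (deflate M v) x = op M x - op (Matrix.vecMulVec v.ofLp v.ofLp)
      (op M (op (Matrix.vecMulVec v.ofLp v.ofLp) x)) := by
    simp only [op_apply, matVec, deflate, Matrix.sub_mulVec, Matrix.mulVec_mulVec,
      Matrix.mul_assoc, WithLp.toLp_sub]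
  rw [h, op_vecMulVec, op_vecMulVec, map_smul, inner_smul_right, mul_comm]

lemma rayleigh_le_of_isTopEigenvector {M : Matrix (Fin d) (Fin d) ℝ} (hM : M.IsSymm) {u : Vec d}
    (hu : IsTopEigenvector M u) :
    ∃ μ : ℝ, op M u = μ • u ∧ ∀ x, inner ℝ x (op M x) ≤ μ * ‖x‖ ^ 2 := by
  obtain ⟨-, μ, h1, h2⟩ := hu
  refine ⟨μ, h1, rayleigh_le_of_top (op_isSymmetric hM) fun ν hν => h2 ν ?_⟩
  obtain ⟨x, hx⟩ := hν.exists_hasEigenvector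
  refine Module.End.hasEigenvalue_of_hasEigenvector (x := x.ofLp)
    (Module.End.hasEigenvector_iff.2 ⟨Module.End.mem_eigenspace_iff.2 ?_, ?_⟩)
  · have := congrArg WithLp.ofLp hx.apply_eq_smul
    simpa [op_apply, matVec] using this
  · exact fun h => hx.2 (by ext i; simp [h])

/-- Only an inequality is available without further assumptions: if the matrix kills an iterate, the
convention `0⁻¹ = 0` makes the next one zero. -/
lemma norm_output_le_one {S : Matrix (Fin d) (Fin d) ℝ} {x₀ : ℕ → Vec d} {t k : ℕ}
    (h : ‖x₀ k‖ = 1) : ‖output S x₀ t k‖ ≤ 1 := by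
  rw [output, powerIteration]
  cases t with
  | zero => exact h.le
  | succ t =>
    rw [Function.iterate_succ_apply', powerStep, norm_smul, norm_inv, norm_norm]
    exact inv_mul_le_one

/-- Disposes of large `ε`, for which the logarithms in the iteration bounds may be negative. -/
lemma accurate_of_two_le {S : Matrix (Fin d) (Fin d) ℝ} {lam : Fin d → ℝ} {ustar : Fin d → Vec d}
    {x₀ u : ℕ → Vec d} {t K : ℕ} {c₀ ε : ℝ} (hS : HasSimplePositiveSpectrum S lam ustar)
    (hinit : GoodInitialization S ustar x₀ u t c₀ K) (hε : 2 ≤ ε) :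
    Accurate S ustar x₀ u t K ε := by
  intro k hk
  have h1 := norm_output_le_one (S := S) (t := t) (hinit.norm_eq_one k hk)
  refine ⟨1, Or.inl rfl, ?_, ?_⟩
  · refine (norm_sub_le _ _).trans ?_
    rw [one_smul, hS.orthonormal.1 k]; linarith
  · refine (norm_sub_le _ _).trans ?_
    rw [one_smul, (hinit.topEigenvector k hk).1]; linarith

lemma one_lt_of_goodInitialization {S : Matrix (Fin d) (Fin d) ℝ} {ustar : Fin d → Vec d}
    {x₀ u : ℕ → Vec d} {t K : ℕ} {c₀ : ℝ} (hc₀ : 0 < c₀) (hK : 1 ≤ K)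
    (hinit : GoodInitialization S ustar x₀ u t c₀ K) : 1 < c₀ := by
  have h := (hinit.overlap 0 hK).trans_le
    (abs_inner_le_one (hinit.norm_eq_one 0 hK) (hinit.topEigenvector 0 hK).1)
  exact (inv_lt_one₀ hc₀).1 h

end Matrices

/-! ### Eigenvalues, gaps and the eigenbasis. -/

section Spectrum

variable {d : ℕ} {S : Matrix (Fin d) (Fin d) ℝ} {lam : Fin d → ℝ} {ustar : Fin d → Vec d}

lemma eig_nonneg (hS : HasSimplePositiveSpectrum S lam ustar) (i : ℕ) : 0 ≤ eig lam i := by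
  rw [eig]; split_ifs with h
  · exact (hS.pos _).le
  · exact le_rfl

lemma eig_pos (hS : HasSimplePositiveSpectrum S lam ustar) {i : ℕ} (h : i < d) :
    0 < eig lam i := by
  rw [eig, dif_pos h]; exact hS.pos _

lemma eig_lt (hS : HasSimplePositiveSpectrum S lam ustar) {i j : ℕ} (hij : i < j) (h : i < d) :
    eig lam j < eig lam i := by
  rw [eig, eig, dif_pos h]
  split_ifs with hj
  · exact hS.strictAnti (by simpa [Fin.lt_def] using hij)
  · exact hS.pos _

lemma eig_antitone (hS : HasSimplePositiveSpectrum S lam ustar) : Antitone (eig lam) := by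
  intro i j hij
  rcases hij.lt_or_eq with hij | rfl
  · by_cases h : i < d
    · exact (eig_lt hS hij h).le
    · rw [eig, eig, dif_neg h, dif_neg (by omega)]
  · exact le_rfl

lemma eig_zero (hS : HasSimplePositiveSpectrum S lam ustar) (hd : 0 < d) : eig lam 0 = 1 := by
  rw [eig, dif_pos hd]; exact hS.first _ rfl

lemma eig_le_one (hS : HasSimplePositiveSpectrum S lam ustar) (i : ℕ) : eig lam i ≤ 1 := by
  rcases Nat.eq_zero_or_pos d with rfl | hd
  · rw [eig, dif_neg (by omega)]; exact zero_le_one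
  · rw [← eig_zero hS hd]; exact eig_antitone hS (Nat.zero_le i)

lemma minGap_le {K k : ℕ} (hk : k < K) : minGap lam K ≤ gap lam k :=
  ciInf_le (Set.finite_range fun k : Fin K => gap lam k).bddBelow ⟨k, hk⟩

lemma minGap_pos (hS : HasSimplePositiveSpectrum S lam ustar) {K : ℕ} (hK : 1 ≤ K) (hKd : K ≤ d) :
    0 < minGap lam K := by
  have : Nonempty (Fin K) := ⟨⟨0, hK⟩⟩
  obtain ⟨i, hi⟩ := exists_eq_ciInf_of_finite (f := fun k : Fin K => gap lam k)
  rw [minGap, ← hi]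
  exact sub_pos.2 (eig_lt hS (Nat.lt_succ_self _) (i.2.trans_le hKd))

/-- The first `K` gaps telescope to `eig lam 0 - eig lam K ≤ 1`. For `K ≥ 2` this forces the minimal
gap below `1 / 2`. -/
lemma mul_minGap_le_one (hS : HasSimplePositiveSpectrum S lam ustar) (K : ℕ) :
    K * minGap lam K ≤ 1 := by
  have h1 : ∑ k ∈ Finset.range K, gap lam k = eig lam 0 - eig lam K :=
    Finset.sum_range_sub' (eig lam) K
  have h2 : ∑ _k ∈ Finset.range K, minGap lam K ≤ ∑ k ∈ Finset.range K, gap lam k :=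
    Finset.sum_le_sum fun k hk => minGap_le (Finset.mem_range.1 hk)
  rw [Finset.sum_const, Finset.card_range, nsmul_eq_mul] at h2
  linarith [eig_nonneg hS K, eig_le_one hS 0]

/-- The eigenvectors as an orthonormal basis. -/
lemma exists_orthonormalBasis (hS : HasSimplePositiveSpectrum S lam ustar) :
    ∃ b : OrthonormalBasis (Fin d) ℝ (Vec d), (∀ j, b j = ustar j) ∧
      ∀ (j : Fin d) x, inner ℝ (b j) (op S x) = eig lam j * inner ℝ (b j) x := by
  have hspan := hS.orthonormal.linearIndependent.span_eq_top_of_card_eq_finrank' (by simp)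
  refine ⟨OrthonormalBasis.mk hS.orthonormal hspan.ge, fun j => by simp, fun j x => ?_⟩
  have h : op S (ustar j) = lam j • ustar j := hS.eigenvector j
  rw [OrthonormalBasis.coe_mk, ← op_isSymmetric hS.isSymm, h, inner_smul_left, eig, dif_pos j.2]
  rfl

end Spectrum

/-! ### Accuracy from sufficiently many power steps. -/

section Accuracy

variable {d : ℕ} {S : Matrix (Fin d) (Fin d) ℝ} {lam : Fin d → ℝ} {ustar : Fin d → Vec d}
  {x₀ u : ℕ → Vec d} {t K : ℕ} {c₀ ε : ℝ}

/-- The deflation method is accurate as soon as every power iteration is sufficiently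
accurate. -/
lemma accurate_of_power_le {θ g : ℝ} (hKd : K ≤ d) (hc₀ : 0 < c₀)
    (hS : HasSimplePositiveSpectrum S lam ustar)
    (hinit : GoodInitialization S ustar x₀ u t c₀ K) (hg : 0 < g) (hgap : ∀ i < K, g ≤ gap lam i)
    (hpow : ∀ k < K, c₀ * ((7 * eig lam (k + 1) + eig lam k) /
      (7 * eig lam k + eig lam (k + 1))) ^ t ≤ θ)
    (hθ : 0 ≤ θ) (hsmall : 10 ^ 6 * K ^ 3 * θ ≤ g ^ 4) (hε : 2 * θ ≤ ε)
    (hε' : 144 * K ^ 2 * θ / g ^ 2 ≤ ε) : Accurate S ustar x₀ u t K ε := by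
  obtain ⟨b, hb, hbS⟩ := exists_orthonormalBasis hS
  set w : ℕ → Vec d := fun i => if h : i < d then b ⟨i, h⟩ else 0 with hwdef
  have hw : ∀ j : Fin d, w j = b j := fun j => by simp [hwdef]
  have hsymm : ∀ i, (op (deflated S x₀ t i)).IsSymmetric := fun i =>
    op_isSymmetric (deflated_isSymm hS.isSymm x₀ t i)
  have hgood : ∀ k, k < K → AccurateStep (fun i => op (deflated S x₀ t i)) (output S x₀ t) u w
      (fun i => inner ℝ (output S x₀ t i) (op (deflated S x₀ t i) (output S x₀ t i))) (eig lam)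
      θ (144 * K ^ 2 * θ / g ^ 2) k := by
    intro k
    induction k using Nat.strong_induction_on with
    | _ k ih =>
      intro hk
      exact accurateStep_of_lt (M := fun i => op (deflated S x₀ t i)) (x₀ := x₀) (t := t)
        b hw hbS hsymm (fun _ => rfl)
        (fun i x => op_deflate _ _ x) (eig_nonneg hS) (eig_le_one hS) (eig_antitone hS) hKd hg
        hgap hc₀ (fun i hi => (hinit.topEigenvector i hi).1)
        (fun i hi => rayleigh_le_of_isTopEigenvector (deflated_isSymm hS.isSymm x₀ t i)
          (hinit.topEigenvector i hi))
        (fun i hi => by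
          have := hinit.oriented ⟨i, hi.trans_le hKd⟩ hi
          rw [hw ⟨i, hi.trans_le hKd⟩, hb, real_inner_comm]
          exact this)
        hinit.norm_eq_one
        (fun i hi => by rw [real_inner_comm]; exact hinit.overlap i hi)
        (fun i hi => rfl) hpow hθ hsmall hk (fun i hi => ih i hi (hi.trans hk))
  intro k hk
  obtain ⟨s, hs, h1, h2⟩ := (hgood k hk).close
  rw [hw, hb] at h1
  exact ⟨s, hs, h1.trans hε', h2.trans hε⟩

/-- Accuracy of the first power iteration. -/
lemma accurate_one_of_power_le {κ : ℝ} (hd : 0 < d) (hc₀ : 0 < c₀)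
    (hS : HasSimplePositiveSpectrum S lam ustar)
    (hinit : GoodInitialization S ustar x₀ u t c₀ 1)
    (hκ0 : 0 ≤ κ) (hκ : ‖orthPart (u 0) (x₀ 0)‖ ≤ κ * |inner ℝ (u 0) (x₀ 0)|)
    (hpow : κ * eig lam 1 ^ t ≤ ε / 2) : Accurate S ustar x₀ u t 1 ε := by
  obtain ⟨b, hb, hbS⟩ := exists_orthonormalBasis hS
  have htop := hinit.topEigenvector 0 one_pos
  obtain ⟨μ, hMu, hray⟩ := rayleigh_le_of_isTopEigenvector hS.isSymm htop
  have h0 := eig_zero hS hd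
  have hlt := eig_lt hS zero_lt_one hd
  have h1 := eig_nonneg hS 1
  have hu := htop.1
  -- With no deflation yet, the perturbation is zero: `u 0` is exactly the first eigenvector and the
  -- contraction rate is exactly `eig lam 1`.
  obtain ⟨hμ, hc, hA⟩ := top_eigenvector_perturbation b (k := ⟨0, hd⟩) (lam := fun j => eig lam j)
    (l' := eig lam 1) (A := op S) (β := 0) (M := op S)
    (fun j x => by rw [if_neg (by simp [Fin.lt_def]), hbS])
    (fun j => eig_nonneg hS j) h1
    (fun j hj => eig_antitone hS (Nat.succ_le_of_lt (Fin.lt_def.1 hj))) hlt (by simp)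
    hu hMu hray
  simp only at hμ hc
  rw [h0] at hμ hc hlt
  have hμ1 : μ = 1 := by
    have := abs_nonpos_iff.1 hμ
    linarith
  have horient := hinit.oriented ⟨0, hd⟩ one_pos
  simp only at horient
  have heq : u 0 = ustar ⟨0, hd⟩ := by
    refine (inner_eq_one_iff_of_norm_eq_one (𝕜 := ℝ) hu (hS.orthonormal.1 _)).1 ?_
    rw [hb, real_inner_comm] at hc
    have h2 := (abs_le.1 (abs_inner_le_one hu (hS.orthonormal.1 ⟨0, hd⟩))).2
    by_contra hne
    have h3 := lt_of_le_of_ne h2 hne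
    have h4 : 0 < 1 - inner ℝ (u 0) (ustar ⟨0, hd⟩) ^ 2 := by nlinarith
    linarith [mul_pos (sub_pos.2 hlt) h4]
  have hux : inner ℝ (u 0) (x₀ 0) ≠ 0 := by
    rw [real_inner_comm]
    exact abs_pos.1 ((inv_pos.2 hc₀).trans (hinit.overlap 0 one_pos))
  obtain ⟨hv, -, hvo⟩ := power_iterate_bound (op_isSymmetric hS.isSymm) hu hMu (a := 1)
    one_pos hμ1.ge h1 (fun x hx => by
      refine abs_le_of_sq_le_sq' ?_ (by positivity) |>.2
      have := hA x hx
      rwa [mul_zero, zero_mul, add_zero, ← mul_pow] at this)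
    (hinit.norm_eq_one 0 one_pos) hux hκ t
  rw [← powerStep_eq, div_one] at hvo
  rw [← powerStep_eq] at hv
  have hθ : ‖orthPart (u 0) (output S x₀ t 0)‖ ≤ ε / 2 := by
    refine hvo.trans (le_trans ?_ hpow)
    exact mul_le_of_le_one_right (by positivity) (abs_inner_le_one hu hv)
  obtain ⟨s, hs, hsv⟩ := exists_sign hu hv
  have hfin : ‖s • output S x₀ t 0 - u 0‖ ≤ ε := by
    have hn := norm_nonneg (orthPart (u 0) (output S x₀ t 0))
    refine abs_le_of_sq_le_sq' (hsv.trans ?_) (by linarith) |>.2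
    change 2 * ‖orthPart (u 0) (output S x₀ t 0)‖ ^ 2 ≤ _
    nlinarith
  intro k hk
  obtain rfl : k = ⟨0, hd⟩ := Fin.ext (by simpa using hk)
  exact ⟨s, hs, by rw [← heq]; exact hfin, hfin⟩

end Accuracy

/-! ### Logarithmic iteration counts and the choice of constants. -/

lemma pow_le_inv_pow_of_log_le {q Y : ℝ} {n t : ℕ} (hq : 0 < q) (hY : 0 < Y)
    (h : n * log Y ≤ t * log q⁻¹) : q ^ t ≤ (Y⁻¹) ^ n := by
  rw [← Real.log_le_log_iff (by positivity) (by positivity), Real.log_pow, Real.log_pow,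
    Real.log_inv]
  rw [Real.log_inv] at h
  linarith

section MainBound

variable {d : ℕ} {S : Matrix (Fin d) (Fin d) ℝ} {lam : Fin d → ℝ} {ustar : Fin d → Vec d}
  {x₀ u : ℕ → Vec d} {t K : ℕ} {c₀ ε : ℝ}

lemma accurate_of_log_le_of_two_le (hK : 2 ≤ K) (hKd : K ≤ d) (hc₀ : 0 < c₀) (hε : 0 < ε)
    (hε2 : ε < 2) (hS : HasSimplePositiveSpectrum S lam ustar)
    (hinit : GoodInitialization S ustar x₀ u t c₀ K)
    (ht : ∀ k < K, 30 * log (c₀ * K / (ε * minGap lam K)) ≤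
      t * log ((7 * eig lam k + eig lam (k + 1)) / (7 * eig lam (k + 1) + eig lam k))) :
    Accurate S ustar x₀ u t K ε := by
  have hg := minGap_pos hS (by omega) hKd
  have hKg := mul_minGap_le_one hS K
  have hc1 := one_lt_of_goodInitialization hc₀ (by omega) hinit
  set g := minGap lam K
  have hK2 : (2 : ℝ) ≤ K := by exact_mod_cast hK
  have hg1 : g ≤ 1 := by nlinarith
  set e := min ε 1 with he
  have he0 : 0 < e := lt_min hε one_pos
  have he1 : e ≤ 1 := min_le_right _ _
  have heε : e ≤ ε := min_le_left _ _
  set X := c₀ * K / g with hX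
  have hX0 : 0 < X := by positivity
  -- From `c₀ > 1`, `K ≥ 2` and `g ≤ 1 / K`. Having `X` bounded away from `1` lets powers of `X⁻¹`
  -- absorb absolute constants.
  have hX4 : 4 ≤ X := by
    rw [hX, le_div_iff₀ hg]
    nlinarith
  have hεX : ε ^ 2 ≤ e * X := by
    rcases le_total ε 1 with h | h
    · rw [he, min_eq_left h]; nlinarith
    · rw [he, min_eq_right h]; nlinarith
  -- Ten factors `X⁻¹` pay for `10 ^ 6`, as `4 ^ 10 > 10 ^ 6`; the other five pay for `c₀`, `K ^ 3`
  -- and `g ^ 4`.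
  have hc : c₀ * (X⁻¹) ^ 15 ≤ g ^ 4 / (10 ^ 6 * K ^ 3) := by
    have h1 : (X⁻¹) ^ 10 ≤ 1 / 10 ^ 6 := by
      calc (X⁻¹) ^ 10 ≤ ((4 : ℝ)⁻¹) ^ 10 := by gcongr
        _ ≤ 1 / 10 ^ 6 := by norm_num
    have h2 : c₀ * (X⁻¹) ^ 5 ≤ g ^ 4 / K ^ 3 := by
      have e1 : c₀ * (X⁻¹) ^ 5 = g ^ 4 / K ^ 3 * (g / (c₀ ^ 4 * K ^ 2)) := by
        rw [hX]; field_simp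
      rw [e1]
      refine mul_le_of_le_one_right (by positivity) ?_
      rw [div_le_one (by positivity)]
      refine hg1.trans (one_le_mul_of_one_le_of_one_le (one_le_pow₀ hc1.le) ?_)
      exact one_le_pow₀ (by linarith)
    calc c₀ * (X⁻¹) ^ 15 = c₀ * (X⁻¹) ^ 5 * (X⁻¹) ^ 10 := by ring
      _ ≤ g ^ 4 / K ^ 3 * (1 / 10 ^ 6) := by gcongr
      _ = _ := by field_simp
  have hK0 : (0 : ℝ) < K := by linarith
  refine accurate_of_power_le (θ := e * (g ^ 4 / (10 ^ 6 * K ^ 3))) (g := g) hKd hc₀ hS hinit hg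
    (fun i hi => minGap_le hi) (fun k hk => ?_) (by positivity) ?_ ?_ ?_
  · have hl := eig_pos hS (hk.trans_le hKd)
    have hl' := eig_nonneg hS (k + 1)
    have h1 := ht k hk
    rw [← inv_div (7 * eig lam (k + 1) + eig lam k)] at h1
    have h2 := pow_le_inv_pow_of_log_le (n := 30) (t := t)
      (q := (7 * eig lam (k + 1) + eig lam k) / (7 * eig lam k + eig lam (k + 1)))
      (Y := c₀ * K / (ε * g)) (by positivity) (by positivity) (by exact_mod_cast h1)
    -- The exponent `30 = 2 * 15`: squaring `ε / X` first makes it at most `e / X` even when `1 < ε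
    -- < 2`.
    have h3 : (c₀ * K / (ε * g))⁻¹ ^ 30 ≤ e * X⁻¹ ^ 15 := by
      have e1 : (c₀ * K / (ε * g))⁻¹ ^ 30 = (ε ^ 2 * X⁻¹ ^ 2) ^ 15 := by
        rw [hX]; field_simp
      have e2 : ε ^ 2 * X⁻¹ ^ 2 ≤ e * X⁻¹ := by
        calc ε ^ 2 * X⁻¹ ^ 2 ≤ e * X * X⁻¹ ^ 2 := by gcongr
          _ = _ := by field_simp
      rw [e1]
      calc (ε ^ 2 * X⁻¹ ^ 2) ^ 15 ≤ (e * X⁻¹) ^ 15 := by gcongr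
        _ = e ^ 15 * X⁻¹ ^ 15 := mul_pow _ _ _
        _ ≤ e * X⁻¹ ^ 15 := by
          gcongr
          exact pow_le_of_le_one he0.le he1 (by norm_num)
    calc _ ≤ c₀ * (e * X⁻¹ ^ 15) := by gcongr; exact h2.trans h3
      _ = e * (c₀ * X⁻¹ ^ 15) := by ring
      _ ≤ _ := by gcongr
  · have : 10 ^ 6 * (K : ℝ) ^ 3 * (e * (g ^ 4 / (10 ^ 6 * K ^ 3))) = e * g ^ 4 := by field_simp
    rw [this]
    exact mul_le_of_le_one_left (by positivity) he1
  · have h1 : g ^ 4 / (10 ^ 6 * K ^ 3) ≤ 1 / 2 := by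
      rw [div_le_iff₀ (by positivity)]
      have := pow_le_one₀ hg.le hg1 (n := 4)
      have := one_le_pow₀ (by linarith : (1 : ℝ) ≤ K) (n := 3)
      linarith
    nlinarith
  · have e1 : 144 * (K : ℝ) ^ 2 * (e * (g ^ 4 / (10 ^ 6 * K ^ 3))) / g ^ 2 =
        e * (144 * g ^ 2 / (10 ^ 6 * K)) := by field_simp
    have h1 : 144 * g ^ 2 / (10 ^ 6 * K) ≤ 1 := by
      rw [div_le_one (by positivity)]
      nlinarith
    rw [e1]
    exact (mul_le_of_le_one_right he0.le h1).trans heε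

lemma accurate_of_log_le_of_one (hd : 1 ≤ d) (hc₀ : 0 < c₀) (hε : 0 < ε)
    (hS : HasSimplePositiveSpectrum S lam ustar)
    (hinit : GoodInitialization S ustar x₀ u t c₀ 1)
    (ht : 30 * log (c₀ * (1 : ℕ) / (ε * minGap lam 1)) ≤
      t * log ((7 * eig lam 0 + eig lam 1) / (7 * eig lam 1 + eig lam 0)))
    (ht' : 1 < d → 30 ≤ t * (log (eig lam 0) - log (eig lam 1))) :
    Accurate S ustar x₀ u t 1 ε := by
  rcases hd.eq_or_lt with rfl | hd1
  -- In dimension one the initial vector is a multiple of `u 0`, so its tangent is zero and any `t`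
  -- works.
  · refine accurate_one_of_power_le (κ := 0) one_pos hc₀ hS hinit le_rfl ?_ (by linarith)
    have hu := (hinit.topEigenvector 0 one_pos).1
    have hu0 : u 0 ≠ 0 := norm_ne_zero_iff.1 (by rw [hu]; exact one_ne_zero)
    obtain ⟨c, hc⟩ := (finrank_eq_one_iff_of_nonzero' (u 0) hu0).1
      (by simp : Module.finrank ℝ (Vec 1) = 1) (x₀ 0)
    rw [← hc]
    simp [orthPart, inner_smul_right, hu]
  · have h0 := eig_zero hS (by omega)
    have h1 := eig_pos hS hd1
    have hlt := eig_lt hS zero_lt_one (by omega)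
    have hg := minGap_pos hS le_rfl (by omega)
    have hg1 := mul_minGap_le_one hS 1
    have ht' := ht' hd1
    rw [h0] at ht hlt ht'
    rw [Real.log_one] at ht'
    rw [Nat.cast_one, one_mul] at hg1
    set q := eig lam 1
    -- The exact rate `q` is at least as good as the perturbed one; cross-multiplied, this is `q ^ 2
    -- ≤ 1`.
    have hlog : log ((7 * 1 + q) / (7 * q + 1)) ≤ log q⁻¹ := by
      refine Real.log_le_log (by positivity) ?_
      rw [div_le_iff₀ (by positivity), inv_mul_eq_div, le_div_iff₀ h1]
      nlinarith
    have hlogc : log (c₀ / ε) ≤ log (c₀ * (1 : ℕ) / (ε * minGap lam 1)) := by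
      refine Real.log_le_log (by positivity) ?_
      rw [Nat.cast_one, mul_one]
      gcongr
      exact mul_le_of_le_one_right hε.le hg1
    have ht2 : 30 * log (c₀ / ε) ≤ t * log q⁻¹ := by
      have := mul_le_mul_of_nonneg_left hlog (Nat.cast_nonneg (α := ℝ) t)
      linarith
    have hlq : t * log q⁻¹ = t * (0 - log q) := by rw [Real.log_inv, zero_sub]
    have hlog2 : log (2 * c₀ / ε) ≤ 1 + log (c₀ / ε) := by
      rw [mul_div_assoc, Real.log_mul (by norm_num) (by positivity)]
      linarith [Real.log_two_lt_d9]
    -- The second bound on `t` makes the right side at least `30`, which covers the additive `1` in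
    -- `hlog2` even if `log (c₀ / ε)` is negative.
    have ht3 : ((1 : ℕ) : ℝ) * log (2 * c₀ / ε) ≤ t * log q⁻¹ := by
      rw [Nat.cast_one, one_mul]
      linarith
    have hpow := pow_le_inv_pow_of_log_le h1 (by positivity) ht3
    have hx₀ := hinit.norm_eq_one 0 one_pos
    have hu := (hinit.topEigenvector 0 one_pos).1
    refine accurate_one_of_power_le (κ := c₀) (by omega) hc₀ hS hinit hc₀.le ?_ ?_
    · have h2 : ‖orthPart (u 0) (x₀ 0)‖ ≤ 1 := by
        refine abs_le_of_sq_le_sq' ?_ zero_le_one |>.2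
        rw [norm_orthPart_sq hu, hx₀]
        nlinarith [sq_nonneg (inner ℝ (u 0) (x₀ 0) : ℝ)]
      refine h2.trans ?_
      rw [← mul_inv_cancel₀ hc₀.ne', real_inner_comm]
      have := hinit.overlap 0 one_pos
      gcongr
    · calc c₀ * q ^ t ≤ c₀ * (2 * c₀ / ε)⁻¹ ^ 1 := by gcongr
        _ = ε / 2 := by rw [pow_one]; field_simp

lemma accurate_of_log_le (hK : 1 ≤ K) (hKd : K ≤ d) (hc₀ : 0 < c₀) (hε : 0 < ε)
    (hS : HasSimplePositiveSpectrum S lam ustar)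
    (hinit : GoodInitialization S ustar x₀ u t c₀ K)
    (ht : ∀ k < K, 30 * (max (log (growth lam c₀ K))
        ((K : ℝ) - ((k : ℝ) + 1) + log (c₀ * K / (ε * minGap lam K))) /
      log ((7 * eig lam k + eig lam (k + 1)) / (7 * eig lam (k + 1) + eig lam k))) ≤ (t : ℝ))
    (ht' : ∀ k, k + 1 < d →
      30 * (1 / (log (eig lam k) - log (eig lam (k + 1)))) ≤ (t : ℝ)) :
    Accurate S ustar x₀ u t K ε := by
  rcases le_or_gt 2 ε with hε2 | hε2
  · exact accurate_of_two_le hS hinit hε2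
  have key : ∀ k < K, 30 * log (c₀ * K / (ε * minGap lam K)) ≤
      t * log ((7 * eig lam k + eig lam (k + 1)) / (7 * eig lam (k + 1) + eig lam k)) := by
    intro k hk
    have hl := eig_pos hS (hk.trans_le hKd)
    have hl' := eig_nonneg hS (k + 1)
    have hlt := eig_lt hS (Nat.lt_succ_self k) (hk.trans_le hKd)
    have hL : 0 < log ((7 * eig lam k + eig lam (k + 1)) / (7 * eig lam (k + 1) + eig lam k)) := by
      refine Real.log_pos ((one_lt_div (by positivity)).2 ?_)
      simp only [Nat.succ_eq_add_one] at hlt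
      linarith
    have h := ht k hk
    rw [← mul_div_assoc, div_le_iff₀ hL] at h
    refine le_trans ?_ h
    gcongr
    refine le_trans ?_ (le_max_right _ _)
    have : (k : ℝ) + 1 ≤ K := by exact_mod_cast hk
    linarith
  rcases hK.eq_or_lt with rfl | hK2
  · refine accurate_of_log_le_of_one hKd hc₀ hε hS hinit (key 0 one_pos) fun hd => ?_
    have hlt := eig_lt hS zero_lt_one (by omega)
    have hL := sub_pos.2 (Real.log_lt_log (eig_pos hS hd) hlt)
    have h := ht' 0 (by omega)
    rwa [mul_one_div, div_le_iff₀ hL] at h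
  · exact accurate_of_log_le_of_two_le hK2 hKd hc₀ hε hε2 hS hinit key

/-- For a fixed spectrum the iteration bounds are dominated by a multiple of `log (K / ε) + K`. -/
lemma exists_iteration_constant (lam : Fin d → ℝ) (hc₀ : 0 < c₀) :
    ∃ C : ℝ, 0 < C ∧ ∀ (K : ℕ) (ε : ℝ), 1 ≤ K → K ≤ d → 0 < ε → ε < 2 → 0 < minGap lam K →
      (∀ k < K, 0 < log ((7 * eig lam k + eig lam (k + 1)) /
          (7 * eig lam (k + 1) + eig lam k)) →
        30 * (max (log (growth lam c₀ K))
          ((K : ℝ) - ((k : ℝ) + 1) + log (c₀ * K / (ε * minGap lam K))) /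
        log ((7 * eig lam k + eig lam (k + 1)) / (7 * eig lam (k + 1) + eig lam k))) ≤
          C * (log (K / ε) + K)) ∧
      (∀ k, k + 1 < d → 30 * (1 / (log (eig lam k) - log (eig lam (k + 1)))) ≤
        C * (log (K / ε) + K)) := by
  -- Absolute values keep these bounds nonnegative for an arbitrary `lam`, so that summing over all
  -- `K ≤ d` and `k < d` dominates each of them by a constant free of `K` and `ε`.
  let B : ℕ → ℕ → ℝ := fun K k => 30 * (1 + 4 * |log (growth lam c₀ K)| +
    4 * |log (c₀ / minGap lam K)|) *
      |log ((7 * eig lam k + eig lam (k + 1)) / (7 * eig lam (k + 1) + eig lam k))|⁻¹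
  let B' : ℕ → ℝ := fun k => 120 * |log (eig lam k) - log (eig lam (k + 1))|⁻¹
  have hB : ∀ K k, 0 ≤ B K k := fun K k => by positivity
  have hB' : ∀ k, 0 ≤ B' k := fun k => by positivity
  set C₁ := ∑ K ∈ Finset.range (d + 1), ∑ k ∈ Finset.range d, B K k
  set C₂ := ∑ k ∈ Finset.range d, B' k
  have hC₁ : 0 ≤ C₁ := Finset.sum_nonneg fun K _ => Finset.sum_nonneg fun k _ => hB K k
  have hC₂ : 0 ≤ C₂ := Finset.sum_nonneg fun k _ => hB' k
  refine ⟨1 + C₁ + C₂, by linarith, fun K ε hK hKd hε hε2 hg => ?_⟩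
  have hK1 : (1 : ℝ) ≤ K := by exact_mod_cast hK
  -- As `ε < 2`, the sum is at least `1 - log 2`. A constant `a ≥ 0` is thus at most `4 a y`, whence
  -- the factors `4` in `B` and `120 = 4 * 30` in `B'`.
  have hy : 1 / 4 ≤ log (K / ε) + K := by
    have h1 : log (1 / 2) ≤ log (K / ε) := by
      refine Real.log_le_log (by norm_num) ?_
      rw [div_le_div_iff₀ (by norm_num) hε]
      linarith
    rw [one_div, Real.log_inv] at h1
    linarith [Real.log_two_lt_d9]
  set y := log (K / ε) + K with hydef
  have hyB : ∀ b, b ≤ 1 + C₁ + C₂ → b * y ≤ (1 + C₁ + C₂) * y := fun b hb => by gcongr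
  refine ⟨fun k hk hL => ?_, fun k hk => ?_⟩
  · have h1 : B K k ≤ C₁ :=
      (Finset.single_le_sum (f := B K) (fun k _ => hB K k)
        (Finset.mem_range.2 (hk.trans_le hKd))).trans
        (Finset.single_le_sum (f := fun K => ∑ k ∈ Finset.range d, B K k)
          (fun K _ => Finset.sum_nonneg fun k _ => hB K k) (Finset.mem_range.2 (by omega)))
    refine le_trans ?_ (hyB (B K k) (by linarith))
    simp only [B]
    rw [abs_of_pos hL, div_eq_mul_inv]
    set a := |log (growth lam c₀ K)|
    set a' := |log (c₀ / minGap lam K)|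
    have ha : 0 ≤ a := abs_nonneg _
    have ha' : 0 ≤ a' := abs_nonneg _
    have hmax : max (log (growth lam c₀ K))
        ((K : ℝ) - ((k : ℝ) + 1) + log (c₀ * K / (ε * minGap lam K))) ≤
        (1 + 4 * a + 4 * a') * y := by
      have e : log (c₀ * K / (ε * minGap lam K)) = log (c₀ / minGap lam K) + log (K / ε) := by
        rw [← Real.log_mul (by positivity) (by positivity)]
        congr 1
        field_simp
      have i1 : log (growth lam c₀ K) ≤ a := le_abs_self _
      have i2 : log (c₀ / minGap lam K) ≤ a' := le_abs_self _
      have i3 := mul_le_mul_of_nonneg_left hy ha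
      have i4 := mul_le_mul_of_nonneg_left hy ha'
      have i5 : (0 : ℝ) ≤ k := Nat.cast_nonneg k
      refine max_le (by linarith) ?_
      rw [e]
      linarith
    calc _ ≤ 30 * ((1 + 4 * a + 4 * a') * y * _) := by gcongr
      _ = _ := by ring
  · have h1 : B' k ≤ C₂ :=
      Finset.single_le_sum (f := B') (fun k _ => hB' k) (Finset.mem_range.2 (by omega))
    refine le_trans ?_ (hyB (B' k) (by linarith))
    simp only [B']
    set L := log (eig lam k) - log (eig lam (k + 1))
    have h2 : L⁻¹ ≤ |L|⁻¹ := by rw [← abs_inv]; exact le_abs_self _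
    have h3 : 0 ≤ |L|⁻¹ := by positivity
    rw [one_div]
    nlinarith

end MainBound

end HotellingDeflation

theorem mainTheorem5 :
    (∃ C : ℝ, 0 < C ∧
      ∀ (d K : ℕ) (S : Matrix (Fin d) (Fin d) ℝ) (lam : Fin d → ℝ) (ustar : Fin d → Vec d)
        (x₀ u : ℕ → Vec d) (t : ℕ) (c₀ ε : ℝ),
        1 ≤ K → K ≤ d → 0 < c₀ → 0 < ε →
        HasSimplePositiveSpectrum S lam ustar →
        GoodInitialization S ustar x₀ u t c₀ K →
        (∀ k < K,
          C * (max (log (growth lam c₀ K))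
                ((K : ℝ) - ((k : ℝ) + 1) + log (c₀ * K / (ε * minGap lam K))) /
              log ((7 * eig lam k + eig lam (k + 1)) / (7 * eig lam (k + 1) + eig lam k)))
            ≤ (t : ℝ)) →
        (∀ k, k + 1 < d → C * (1 / (log (eig lam k) - log (eig lam (k + 1)))) ≤ (t : ℝ)) →
        Accurate S ustar x₀ u t K ε) ∧
    (∀ (d : ℕ) (lam : Fin d → ℝ) (c₀ : ℝ), 0 < c₀ →
      ∃ C : ℝ, 0 < C ∧
        ∀ (K : ℕ) (S : Matrix (Fin d) (Fin d) ℝ) (ustar : Fin d → Vec d)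
          (x₀ u : ℕ → Vec d) (t : ℕ) (ε : ℝ),
          1 ≤ K → K ≤ d → 0 < ε →
          HasSimplePositiveSpectrum S lam ustar →
          GoodInitialization S ustar x₀ u t c₀ K →
          C * (log (K / ε) + K) ≤ (t : ℝ) →
          Accurate S ustar x₀ u t K ε) := by
  refine ⟨⟨30, by norm_num, fun d K S lam ustar x₀ u t c₀ ε hK hKd hc₀ hε hS hinit ht ht' =>
    accurate_of_log_le hK hKd hc₀ hε hS hinit ht ht'⟩, fun d lam c₀ hc₀ => ?_⟩
  obtain ⟨C, hC, h⟩ := exists_iteration_constant lam hc₀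
  refine ⟨C, hC, fun K S ustar x₀ u t ε hK hKd hε hS hinit ht => ?_⟩
  rcases le_or_gt 2 ε with hε2 | hε2
  · exact accurate_of_two_le hS hinit hε2
  obtain ⟨h1, h2⟩ := h K ε hK hKd hε hε2 (minGap_pos hS hK hKd)
  refine accurate_of_log_le hK hKd hc₀ hε hS hinit (fun k hk => (h1 k hk ?_).trans ht)
    (fun k hk => (h2 k hk).trans ht)
  have hl := eig_pos hS (hk.trans_le hKd)
  have hl' := eig_nonneg hS (k + 1)
  have hlt := eig_lt hS (Nat.lt_succ_self k) (hk.trans_le hKd)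
  refine Real.log_pos ((one_lt_div (by positivity)).2 ?_)
  simp only [Nat.succ_eq_add_one] at hlt
  linarith
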